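/- Let $M$ and $N$ be smooth Riemannian manifolds of dimension $n$ (Hausdorff, second countable, without boundary), with Riemannian distances $d_M,d_N$ and Riemannian volume measures $\mathrm{vol}_M,\mathrm{vol}_N$ (given by $\sqrt{\det(g_{ij})}\,dx^1\cdots dx^n$ in local coordinates). Let $x_0\in M$ and let $0<\delta<\operatorname{inj}(M)$, where $\operatorname{inj}(M)$ is the injectivity radius. Let $k=k(x_0,\cdot):M\to\mathbb R$ vanish outside the closed ball $\{y: d_M(x_0,y)\le\delta\}$. For $x\in M$ and a geodesic $\gamma:[0,1]\to M$ from $x_0$ to $x$, let $\mathrm{PT}_{x_0}^{x}:T_{x_0}M\to T_xM$ be the Levi-Civita parallel transport along $\gamma$, let $\exp_x^{-1}$ be the inverse of $\exp_x$ restricted to $\{v\in T_xM:|v|\le\delta\}$, and put $$k_\gamma(x,y)=k\bigl(x_0,\ \exp_{x_0}\circ(\mathrm{PT}_{x_0}^{x})^{-1}\circ\exp_x^{-1}(y)\bigr)\ \text{ if } d_M(x,y)\le\delta,\qquad k_\gamma(x,y)=0\ \text{ otherwise.}$$ The parallel transport convolution of $f:M\to\mathbb R$ with $k$ at $x$, along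 $\gamma$, is $$(f*_M k)_\gamma(x)=\int_M f(y)\,k_\gamma(x,y)\,d\mathrm{vol}_M(y).$$ **Theorem.** Let $\Phi:M\to N$ be an isometry, i.e. a diffeomorphism that preserves the Riemannian metrics. Then parallel transport convolution is invariant under $\Phi$. Precisely: 1. $\delta<\operatorname{inj}(N)$, the function $k\circ\Phi^{-1}$ vanishes outside the closed ball of radius $\delta$ around $\Phi(x_0)$, and $\Phi_*\mathrm{vol}_M=\mathrm{vol}_N$. 2. For every $x\in M$ and every geodesic $\gamma$ from $x_0$ to $x$, the curve $\Phi\circ\gamma$ is a geodesic from $\Phi(x_0)$ to $\Phi(x)$, minimizing if $\gamma$ is; for $v\in T_{x_0}M$ and $w\in T_xM$, $w$ is the parallel transport of $v$ along $\gamma$ if and only if $d\Phi_x(w)$ is the parallel transport of $d\Phi_{x_0}(v)$ along $\Phi\circ\gamma$; and $$\bigl((f\circ\Phi^{-1})*_N(k\circ\Phi^{-1})\bigr)_{\Phi\circ\gamma}(\Phi(x))=(f*_M k)_\gamma(x)\qquad\text{for every } f:M\to\mathbb R,$$ where the integrand on one side is integrable if and only if the integrand on the other side is (if they are not integrable, both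 integrals are read as $0$). 3. In particular, if the minimizing geodesic $\gamma$ from $x_0$ to $x$ is unique, then $$\bigl((f\circ\Phi^{-1})*_N(k\circ\Phi^{-1})\bigr)_{\gamma'}(\Phi(x))=(f*_M k)_\gamma(x)$$ for every minimizing geodesic $\gamma'$ from $\Phi(x_0)$ to $\Phi(x)$. -/

import Mathlib

open Set MeasureTheory Manifold Bundle
open scoped ContDiff ENNReal

noncomputable section

namespace PTC

/-- Coordinate space of an `n`-dimensional manifold. -/
abbrev Coord (n : ℕ) : Type := EuclideanSpace ℝ (Fin n)

/-- The `i`-th standard basis vector of the coordinate space. -/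
def stdVec (n : ℕ) (i : Fin n) : Coord n := EuclideanSpace.single i (1 : ℝ)

section Metric

variable {n : ℕ} {M : Type*} [TopologicalSpace M] [ChartedSpace (Coord n) M]
  [RiemannianBundle (fun x : M ↦ TangentSpace (𝓡 n) x)]

/-- The matrix `g_ij(y) = ⟨∂_i, ∂_j⟩` of the Riemannian metric in the chart `e`, as a function of
the coordinates `y ∈ e.target`; here `∂_i = d(e⁻¹)_y (stdVec i)`. -/
def metricMatrix (e : OpenPartialHomeomorph M (Coord n)) (y : Coord n) :
    Matrix (Fin n) (Fin n) ℝ :=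
  Matrix.of fun i j ↦
    inner ℝ (mfderiv (𝓡 n) (𝓡 n) e.symm y (stdVec n i) : TangentSpace (𝓡 n) (e.symm y))
      (mfderiv (𝓡 n) (𝓡 n) e.symm y (stdVec n j) : TangentSpace (𝓡 n) (e.symm y))

/-- The coordinate derivative `∂_l g_ij` at `y`. -/
def metricDeriv (e : OpenPartialHomeomorph M (Coord n)) (y : Coord n) (l i j : Fin n) : ℝ :=
  fderiv ℝ (fun z ↦ metricMatrix e z i j) y (stdVec n l)

/-- The Christoffel symbols of the Levi-Civita connection in the chart `e`:
`Γ^k_ij = ½ ∑_l g^{kl} (∂_i g_jl + ∂_j g_il - ∂_l g_ij)`. -/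
def christoffel (e : OpenPartialHomeomorph M (Coord n)) (y : Coord n) (k i j : Fin n) : ℝ :=
  (1 / 2 : ℝ) * ∑ l, (metricMatrix e y)⁻¹ k l *
    (metricDeriv e y i j l + metricDeriv e y j i l - metricDeriv e y l i j)

/-- A geodesic `γ : [0,1] → M`: a smooth curve with `∇_γ' γ' = 0`, i.e. satisfying in all local
coordinates `γ''^k + ∑ Γ^k_ij γ'^i γ'^j = 0`. Values of `γ` outside `[0,1]` are irrelevant. -/
structure IsGeodesic (γ : ℝ → M) : Prop where
  smooth : ContMDiffOn 𝓘(ℝ, ℝ) (𝓡 n) ∞ γ (Icc 0 1)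
  equation : ∀ t ∈ Icc (0 : ℝ) 1, ∀ e ∈ IsManifold.maximalAtlas (𝓡 n) ∞ M, γ t ∈ e.source →
    ∀ k : Fin n,
      iteratedDerivWithin 2 (fun s ↦ (e (γ s)) k) (Icc 0 1) t
        + ∑ i, ∑ j, christoffel e (e (γ t)) k i j
            * derivWithin (fun s ↦ (e (γ s)) i) (Icc 0 1) t
            * derivWithin (fun s ↦ (e (γ s)) j) (Icc 0 1) t = 0

/-- A geodesic `γ : [0,1] → M` from `x₀` to `x`. -/
structure IsGeodesicFromTo (x₀ x : M) (γ : ℝ → M) : Prop where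
  geodesic : IsGeodesic (n := n) γ
  source : γ 0 = x₀
  target : γ 1 = x

/-- A minimizing geodesic from `x₀` to `x`: its length is the Riemannian distance. -/
structure IsMinGeodesicFromTo (x₀ x : M) (γ : ℝ → M) : Prop
    extends IsGeodesicFromTo (n := n) x₀ x γ where
  minimizing : pathELength (𝓡 n) γ 0 1 = riemannianEDist (𝓡 n) x₀ x

/-- The vector `(v¹, …, vⁿ)` of components of a tangent vector `v = ∑ vⁱ ∂_i` in the chart `e`. -/
def components (e : OpenPartialHomeomorph M (Coord n)) {x : M} (v : TangentSpace (𝓡 n) x) :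
    Coord n :=
  mfderiv (𝓡 n) (𝓡 n) e x v

/-- `X` is a parallel vector field along the curve `γ : [0,1] → M`, i.e. `∇_γ' X = 0`: in all local
coordinates the components `a^k` of `X` satisfy `(a^k)' + ∑ Γ^k_ij γ'^i a^j = 0`. -/
def IsParallelAlong (γ : ℝ → M) (X : ∀ t, TangentSpace (𝓡 n) (γ t)) : Prop :=
  ∀ t ∈ Icc (0 : ℝ) 1, ∀ e ∈ IsManifold.maximalAtlas (𝓡 n) ∞ M, γ t ∈ e.source →
    ∀ k : Fin n,
      HasDerivWithinAt
        (fun s ↦ components e (X s) k)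
        (-∑ i, ∑ j, christoffel e (e (γ t)) k i j
            * derivWithin (fun s ↦ (e (γ s)) i) (Icc 0 1) t
            * components e (X t) j)
        (Icc 0 1) t

/-- The graph of parallel transport `PT : T_{x₀} M → T_x M` along a curve `γ` from `x₀` to `x`:
`w = PT v` if some parallel field along `γ` starts at `v` and ends at `w`. -/
def IsParallelTransport (γ : ℝ → M) {x₀ x : M} (v : TangentSpace (𝓡 n) x₀)
    (w : TangentSpace (𝓡 n) x) : Prop :=
  ∃ X : ∀ t, TangentSpace (𝓡 n) (γ t), IsParallelAlong γ X ∧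
    (⟨γ 0, X 0⟩ : TangentBundle (𝓡 n) M) = ⟨x₀, v⟩ ∧
    (⟨γ 1, X 1⟩ : TangentBundle (𝓡 n) M) = ⟨x, w⟩

open Classical in
/-- The inverse `(PT_{x₀}^x)⁻¹ : T_x M → T_{x₀} M` of parallel transport along `γ`: the (unique)
`v` whose parallel transport along `γ` is `w`. -/
def parallelTransportInv (γ : ℝ → M) (x₀ x : M) (w : TangentSpace (𝓡 n) x) :
    TangentSpace (𝓡 n) x₀ :=
  if h : ∃ v : TangentSpace (𝓡 n) x₀, IsParallelTransport γ v w then h.choose else 0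

/-- `γ : [0,1] → M` is a geodesic with `γ(0) = x` and `γ'(0) = v`. -/
def IsGeodesicWith (x : M) (v : TangentSpace (𝓡 n) x) (γ : ℝ → M) : Prop :=
  IsGeodesic (n := n) γ ∧
    (⟨γ 0, mfderivWithin 𝓘(ℝ, ℝ) (𝓡 n) γ (Icc 0 1) 0 (1 : ℝ)⟩ : TangentBundle (𝓡 n) M) = ⟨x, v⟩

open Classical in
/-- The exponential map: `exp_x v = γ(1)` for the (unique) geodesic `γ : [0,1] → M` with
`γ(0) = x`, `γ'(0) = v`. Where no such geodesic exists it takes the dummy value `x`. -/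
def expMap (x : M) (v : TangentSpace (𝓡 n) x) : M :=
  if h : ∃ γ : ℝ → M, IsGeodesicWith x v γ then h.choose 1 else x

/-- The injectivity radius at `x`: the supremum of the radii `r` such that `exp_x` is defined on
the ball of radius `r` in `T_x M` and is a diffeomorphism of it onto its image. -/
def injectivityRadiusAt (n : ℕ) {M : Type*} [TopologicalSpace M] [ChartedSpace (Coord n) M]
    [RiemannianBundle (fun x : M ↦ TangentSpace (𝓡 n) x)] (x : M) : ℝ≥0∞ :=
  sSup {r : ℝ≥0∞ |
    (∀ v : TangentSpace (𝓡 n) x, ‖v‖ₑ < r → ∃ γ : ℝ → M, IsGeodesicWith x v γ) ∧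
    InjOn (expMap (n := n) x) {v | ‖v‖ₑ < r} ∧
    IsLocalDiffeomorphOn 𝓘(ℝ, TangentSpace (𝓡 n) x) (𝓡 n) ∞ (expMap (n := n) x) {v | ‖v‖ₑ < r}}

/-- The injectivity radius of `M`. -/
def injectivityRadius (n : ℕ) (M : Type*) [TopologicalSpace M] [ChartedSpace (Coord n) M]
    [RiemannianBundle (fun x : M ↦ TangentSpace (𝓡 n) x)] : ℝ≥0∞ :=
  ⨅ x : M, injectivityRadiusAt n x

open Classical in
/-- The inverse `exp_x⁻¹` of the exponential map restricted to the closed `δ`-ball of `T_x M`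
(dummy value `0` at points that are not in the image). -/
def logMap (δ : ℝ) (x y : M) : TangentSpace (𝓡 n) x :=
  if h : ∃ v : TangentSpace (𝓡 n) x, ‖v‖ ≤ δ ∧ expMap x v = y then h.choose else 0

/-- `k = k(x₀, ·)` is a kernel centred at `x₀` with radius `δ`: it vanishes outside the closed
geodesic ball `M(x₀, δ)`, and `δ` is smaller than the injectivity radius of `M`. -/
structure IsKernel (n : ℕ) {M : Type*} [TopologicalSpace M] [ChartedSpace (Coord n) M]
    [RiemannianBundle (fun x : M ↦ TangentSpace (𝓡 n) x)] (x₀ : M) (δ : ℝ) (k : M → ℝ) :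
    Prop where
  pos : 0 < δ
  lt_injectivityRadius : ENNReal.ofReal δ < injectivityRadius n M
  support : ∀ y, ENNReal.ofReal δ < riemannianEDist (𝓡 n) x₀ y → k y = 0

open Classical in
/-- The kernel `k(x, ·)` obtained from `k = k(x₀, ·)` by parallel transport along `γ` from `x₀`
to `x`: it is `y ↦ k (x₀, exp_{x₀} ∘ (PT_{x₀}^x)⁻¹ ∘ exp_x⁻¹ (y))` on the closed geodesic ball
`M(x, δ)` and `0` outside. -/
def transportedKernel (n : ℕ) {M : Type*} [TopologicalSpace M] [ChartedSpace (Coord n) M]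
    [RiemannianBundle (fun x : M ↦ TangentSpace (𝓡 n) x)]
    (x₀ : M) (δ : ℝ) (k : M → ℝ) (γ : ℝ → M) (x y : M) : ℝ :=
  if riemannianEDist (𝓡 n) x y ≤ ENNReal.ofReal δ then
    k (expMap (n := n) x₀ (parallelTransportInv γ x₀ x (logMap δ x y)))
  else 0

end Metric

section Volume

variable (n : ℕ) {M : Type*} [TopologicalSpace M] [ChartedSpace (Coord n) M]
  [RiemannianBundle (fun x : M ↦ TangentSpace (𝓡 n) x)] [MeasurableSpace M]

/-- The measure `√(det g_ij) dx¹ ⋯ dxⁿ` on the domain of the chart `e`, extended by zero to `M`. -/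
def chartVolume (e : OpenPartialHomeomorph M (Coord n)) : Measure M :=
  ((volume.restrict e.target).withDensity
    (fun y ↦ ENNReal.ofReal (Real.sqrt (metricMatrix e y).det))).map e.symm

/-- The Riemannian volume measure. The measures `√(det g_ij) dx¹ ⋯ dxⁿ` of two smooth charts agree
on the overlap of the chart domains, so that their supremum is the measure on `M` which restricts
to `√(det g_ij) dx¹ ⋯ dxⁿ` on the domain of every smooth chart. -/
def riemannianVolume (M : Type*) [TopologicalSpace M] [ChartedSpace (Coord n) M]
    [RiemannianBundle (fun x : M ↦ TangentSpace (𝓡 n) x)] [MeasurableSpace M] : Measure M :=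
  ⨆ e ∈ IsManifold.maximalAtlas (𝓡 n) ∞ M, chartVolume n e

/-- The integrand `y ↦ f(y) k(x, y)` of the parallel transport convolution at `x`, the kernel being
transported along the geodesic `γ` from `x₀` to `x`. -/
def ptcIntegrand (n : ℕ) {M : Type*} [TopologicalSpace M] [ChartedSpace (Coord n) M]
    [RiemannianBundle (fun x : M ↦ TangentSpace (𝓡 n) x)]
    (x₀ : M) (δ : ℝ) (k f : M → ℝ) (γ : ℝ → M) (x y : M) : ℝ :=
  f y * transportedKernel n x₀ δ k γ x y

/-- The parallel transport convolution `(f *_M k)(x) = ∫_M f(y) k(x, y) d_M y`, the kernel being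
transported along the geodesic `γ` from `x₀` to `x`. -/
def ptConvolution (x₀ : M) (δ : ℝ) (k f : M → ℝ) (γ : ℝ → M) (x : M) : ℝ :=
  ∫ y, ptcIntegrand n x₀ δ k f γ x y ∂(riemannianVolume n M)

end Volume

/-- An isometry of Riemannian manifolds: a diffeomorphism preserving the Riemannian metric. -/
def IsRiemannianIsometry {n : ℕ} {M N : Type*}
    [TopologicalSpace M] [ChartedSpace (Coord n) M]
    [RiemannianBundle (fun x : M ↦ TangentSpace (𝓡 n) x)]
    [TopologicalSpace N] [ChartedSpace (Coord n) N]
    [RiemannianBundle (fun x : N ↦ TangentSpace (𝓡 n) x)]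
    (Φ : M ≃ₘ^∞⟮𝓡 n, 𝓡 n⟯ N) : Prop :=
  ∀ (x : M) (v w : TangentSpace (𝓡 n) x),
    inner ℝ (mfderiv (𝓡 n) (𝓡 n) Φ x v) (mfderiv (𝓡 n) (𝓡 n) Φ x w) = inner ℝ v w

end PTC

end

/-!
If `e` is a chart of `N`, then `e ∘ Φ` is a chart of `M` and, `Φ` being an isometry, the metric has
the same coefficients `g_ij` in both; hence so do the Christoffel symbols and the volume density.
So `Φ` carries geodesics to geodesics, `dΦ` carries parallel fields to parallel fields, and the
volume measures correspond. Since `exp`, `(PT)⁻¹` and `exp⁻¹` are defined by choosing a solution,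
they commute with `dΦ` only because that solution is unique: by uniqueness for the (locally
Lipschitz) geodesic and parallel transport equations in the first two cases, by injectivity of `exp`
below the injectivity radius in the last one. The invariance of the convolution is then the change
of variables `y ↦ Φ y`.
-/

noncomputable section
namespace PTC
open Filter
open scoped Topology

section ODE

variable {E : Type*} [NormedAddCommGroup E] [NormedSpace ℝ E] {v : ℝ → E → E} {f g : ℝ → E}
  {a b t : ℝ} {K : NNReal}

lemma eqOn_Icc_of_hasDerivWithinAt {U : ℝ → Set E} (ht : t ∈ Icc a b)
    (hv : ∀ s ∈ Icc a b, LipschitzOnWith K (v s) (U s))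
    (hf : ∀ s ∈ Icc a b, HasDerivWithinAt f (v s (f s)) (Icc a b) s)
    (hfU : ∀ s ∈ Icc a b, f s ∈ U s)
    (hg : ∀ s ∈ Icc a b, HasDerivWithinAt g (v s (g s)) (Icc a b) s)
    (hgU : ∀ s ∈ Icc a b, g s ∈ U s)
    (hfg : f t = g t) : EqOn f g (Icc a b) := by
  have hfc : ContinuousOn f (Icc a b) := fun s hs ↦ (hf s hs).continuousWithinAt
  have hgc : ContinuousOn g (Icc a b) := fun s hs ↦ (hg s hs).continuousWithinAt
  rw [← Icc_union_Icc_eq_Icc ht.1 ht.2]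
  refine EqOn.union ?_ ?_
  · have hsub : Icc a t ⊆ Icc a b := Icc_subset_Icc_right ht.2
    have hmem : ∀ s ∈ Ioc a t, Icc a b ∈ 𝓝[≤] s := fun s hs ↦
      mem_of_superset (Icc_mem_nhdsLE hs.1) (Icc_subset_Icc_right (hs.2.trans ht.2))
    have hIoc : ∀ s ∈ Ioc a t, s ∈ Icc a b := fun s hs ↦ hsub (Ioc_subset_Icc_self hs)
    exact ODE_solution_unique_of_mem_Icc_left
      (fun s hs ↦ hv s (hIoc s hs))
      (hfc.mono hsub) (fun s hs ↦ (hf s (hIoc s hs)).mono_of_mem_nhdsWithin (hmem s hs))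
      (fun s hs ↦ hfU s (hIoc s hs))
      (hgc.mono hsub) (fun s hs ↦ (hg s (hIoc s hs)).mono_of_mem_nhdsWithin (hmem s hs))
      (fun s hs ↦ hgU s (hIoc s hs)) hfg
  · have hsub : Icc t b ⊆ Icc a b := Icc_subset_Icc_left ht.1
    have hmem : ∀ s ∈ Ico t b, Icc a b ∈ 𝓝[≥] s := fun s hs ↦
      mem_of_superset (Icc_mem_nhdsGE hs.2) (Icc_subset_Icc_left (ht.1.trans hs.1))
    have hIco : ∀ s ∈ Ico t b, s ∈ Icc a b := fun s hs ↦ hsub (Ico_subset_Icc_self hs)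
    exact ODE_solution_unique_of_mem_Icc_right
      (fun s hs ↦ hv s (hIco s hs))
      (hfc.mono hsub) (fun s hs ↦ (hf s (hIco s hs)).mono_of_mem_nhdsWithin (hmem s hs))
      (fun s hs ↦ hfU s (hIco s hs))
      (hgc.mono hsub) (fun s hs ↦ (hg s (hIco s hs)).mono_of_mem_nhdsWithin (hmem s hs))
      (fun s hs ↦ hgU s (hIco s hs)) hfg

lemma eventually_eq_iff_of_hasDerivWithinAt {U : Set E} (ht : t ∈ Icc a b) (hU : U ∈ 𝓝 (f t))
    (hv : ∀ᶠ s in 𝓝[Icc a b] t, LipschitzOnWith K (v s) U)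
    (hf : ∀ᶠ s in 𝓝[Icc a b] t, HasDerivWithinAt f (v s (f s)) (Icc a b) s)
    (hg : ∀ᶠ s in 𝓝[Icc a b] t, HasDerivWithinAt g (v s (g s)) (Icc a b) s) :
    ∀ᶠ s in 𝓝[Icc a b] t, f t = g t ↔ f s = g s := by
  have hfc : ContinuousWithinAt f (Icc a b) t := (hf.self_of_nhdsWithin ht).continuousWithinAt
  have hgc : ContinuousWithinAt g (Icc a b) t := (hg.self_of_nhdsWithin ht).continuousWithinAt
  rcases ne_or_eq (f t) (g t) with hne | heq
  · filter_upwards [(hfc.sub hgc).eventually_ne (sub_ne_zero.2 hne)] with s hs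
    exact iff_of_false hne (sub_ne_zero.1 hs)
  have hfU : ∀ᶠ s in 𝓝[Icc a b] t, f s ∈ U := hfc hU
  have hgU : ∀ᶠ s in 𝓝[Icc a b] t, g s ∈ U := hgc (heq ▸ hU)
  obtain ⟨W, hW, hall⟩ := mem_nhdsWithin_iff_exists_mem_nhds_inter.1
    (hv.and (hf.and (hfU.and (hg.and hgU))))
  obtain ⟨c, d, htcd, hcd, hcdW⟩ := exists_Icc_mem_subset_of_mem_nhds hW
  have hsub : Icc c d ∩ Icc a b ⊆ Icc a b := inter_subset_right
  replace hall := (inter_subset_inter_left _ hcdW).trans hall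
  have htmem : t ∈ Icc c d ∩ Icc a b := ⟨htcd, ht⟩
  suffices EqOn f g (Icc c d ∩ Icc a b) by
    filter_upwards [inter_mem (mem_nhdsWithin_of_mem_nhds hcd) self_mem_nhdsWithin] with s hs
    exact iff_of_true heq (this hs)
  rw [Icc_inter_Icc] at hall hsub htmem ⊢
  exact eqOn_Icc_of_hasDerivWithinAt (U := fun _ ↦ U) htmem (fun s hs ↦ (hall hs).1)
    (fun s hs ↦ (hall hs).2.1.mono hsub) (fun s hs ↦ (hall hs).2.2.1)
    (fun s hs ↦ (hall hs).2.2.2.1.mono hsub) (fun s hs ↦ (hall hs).2.2.2.2) heq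

lemma exists_eventually_lipschitzOnWith {P F : Type*} [NormedAddCommGroup P] [NormedSpace ℝ P]
    [NormedAddCommGroup F] [NormedSpace ℝ F]
    {G : P × E → F} {p : P} {x : E} (hG : ContDiffAt ℝ 1 G (p, x)) :
    ∃ K, ∃ U ∈ 𝓝 x, ∀ᶠ q in 𝓝 p, LipschitzOnWith K (fun y ↦ G (q, y)) U := by
  obtain ⟨K, W, hW, hK⟩ := hG.exists_lipschitzOnWith
  obtain ⟨A, hA, U, hU, hAU⟩ := mem_nhds_prod_iff.1 hW
  refine ⟨K, U, hU, ?_⟩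
  filter_upwards [hA] with q hq
  simpa only [mul_one, Function.comp_def] using
    hK.comp (LipschitzWith.prodMk_left q).lipschitzOnWith (fun y hy ↦ hAU ⟨hq, hy⟩)

lemma iff_of_isPreconnected {α : Type*} [TopologicalSpace α] {s : Set α} {P : α → Prop}
    (hs : IsPreconnected s) (hP : ∀ x ∈ s, ∀ᶠ y in 𝓝[s] x, P x ↔ P y) {x y : α} (hx : x ∈ s)
    (hy : y ∈ s) : P x ↔ P y :=
  hs.induction₂ (fun x y ↦ (P x ↔ P y)) hP (fun _ _ _ _ _ _ ↦ Iff.trans)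
    (fun _ _ _ _ ↦ Iff.symm) hx hy

end ODE

section MatrixSmoothness

variable {𝕜 E ι : Type*} [NontriviallyNormedField 𝕜] [NormedAddCommGroup E] [NormedSpace 𝕜 E]
  [Fintype ι] [DecidableEq ι] {s : Set E} {r : ℕ∞ω}

section Ring

variable {𝔸 : Type*} [NormedCommRing 𝔸] [NormedAlgebra 𝕜 𝔸] {A : E → Matrix ι ι 𝔸}

lemma contDiffOn_det (hA : ∀ i j, ContDiffOn 𝕜 r (fun x ↦ A x i j) s) :
    ContDiffOn 𝕜 r (fun x ↦ (A x).det) s := by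
  simp only [Matrix.det_apply]
  exact ContDiffOn.sum fun σ _ ↦ (contDiffOn_prod fun k _ ↦ hA (σ k) k).const_smul _

lemma contDiffOn_adjugate (hA : ∀ i j, ContDiffOn 𝕜 r (fun x ↦ A x i j) s) (i j : ι) :
    ContDiffOn 𝕜 r (fun x ↦ (A x).adjugate i j) s := by
  simp only [Matrix.adjugate_apply]
  refine contDiffOn_det fun k l ↦ ?_
  rcases eq_or_ne k j with rfl | hkj
  · simpa only [Matrix.updateRow_self] using contDiffOn_const
  · simpa only [Matrix.updateRow_ne hkj] using hA k l

end Ring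

lemma contDiffOn_matrix_inv {𝕜' : Type*} [NormedField 𝕜'] [NormedAlgebra 𝕜 𝕜']
    {A : E → Matrix ι ι 𝕜'} (hA : ∀ i j, ContDiffOn 𝕜 r (fun x ↦ A x i j) s)
    (hdet : ∀ x ∈ s, (A x).det ≠ 0) (i j : ι) : ContDiffOn 𝕜 r (fun x ↦ (A x)⁻¹ i j) s := by
  simp only [Matrix.inv_def, Ring.inverse_eq_inv', Matrix.smul_apply, smul_eq_mul]
  exact ((contDiffOn_det hA).inv hdet).mul (contDiffOn_adjugate hA i j)

end MatrixSmoothness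

section Charts

variable {𝕜 E H : Type*} [NontriviallyNormedField 𝕜] [NormedAddCommGroup E] [NormedSpace 𝕜 E]
  [TopologicalSpace H] {I : ModelWithCorners 𝕜 E H} {r : ℕ∞ω}
  {M : Type*} [TopologicalSpace M] [ChartedSpace H M]
  {N : Type*} [TopologicalSpace N] [ChartedSpace H N]

/-- The chart `e ∘ Φ` of `M` obtained from a diffeomorphism `Φ : M → N` and a chart `e` of `N`. -/
def pullbackChart (Φ : M ≃ₘ^r⟮I, I⟯ N) (e : OpenPartialHomeomorph N H) :
    OpenPartialHomeomorph M H :=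
  Φ.toHomeomorph.transOpenPartialHomeomorph e

@[simp]
lemma pullbackChart_apply (Φ : M ≃ₘ^r⟮I, I⟯ N) (e : OpenPartialHomeomorph N H) (x : M) :
    pullbackChart Φ e x = e (Φ x) := rfl

@[simp]
lemma pullbackChart_target (Φ : M ≃ₘ^r⟮I, I⟯ N) (e : OpenPartialHomeomorph N H) :
    (pullbackChart Φ e).target = e.target := rfl

lemma pullbackChart_mem_maximalAtlas [IsManifold I r M]
    (Φ : M ≃ₘ^r⟮I, I⟯ N) {e : OpenPartialHomeomorph N H} (he : e ∈ IsManifold.maximalAtlas I r N) :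
    pullbackChart Φ e ∈ IsManifold.maximalAtlas I r M := by
  rw [IsManifold.mem_maximalAtlas_iff_contMDiffOn]
  exact ⟨(contMDiffOn_of_mem_maximalAtlas he).comp Φ.contMDiff.contMDiffOn fun x hx ↦ hx,
    Φ.symm.contMDiff.comp_contMDiffOn (contMDiffOn_symm_of_mem_maximalAtlas he)⟩

lemma mdifferentiable_of_mem_maximalAtlas {e : OpenPartialHomeomorph M H}
    (he : e ∈ IsManifold.maximalAtlas I r M) (hr : r ≠ 0) : e.MDifferentiable I I :=
  ⟨(contMDiffOn_of_mem_maximalAtlas he).mdifferentiableOn hr,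
    (contMDiffOn_symm_of_mem_maximalAtlas he).mdifferentiableOn hr⟩

lemma mfderiv_symm_apply_mfderiv (Φ : M ≃ₘ^r⟮I, I⟯ N) (hr : r ≠ 0) (x : M)
    (v : TangentSpace I x) : mfderiv I I Φ.symm (Φ x) (mfderiv I I Φ x v) = v :=
  DFunLike.congr_fun ((Φ.toOpenPartialHomeomorph_mdifferentiable hr).symm_comp_deriv (mem_univ x)) v

lemma tangentMap_symm_tangentMap (Φ : M ≃ₘ^r⟮I, I⟯ N) (hr : r ≠ 0) (p : TangentBundle I M) :
    tangentMap I I Φ.symm (tangentMap I I Φ p) = p := by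
  rw [← tangentMap_comp_at p (Φ.symm.mdifferentiable hr _) (Φ.mdifferentiable hr _),
    show Φ.symm ∘ Φ = id from funext Φ.symm_apply_apply, tangentMap_id, id]

end Charts

section LeviCivita

variable {n : ℕ} {M : Type*} [TopologicalSpace M] [ChartedSpace (Coord n) M]
  {e : OpenPartialHomeomorph M (Coord n)}

/-- The vector `Γ(y)(u, a)` with entries `∑ Γ^k_ij u^i a^j`: in the chart `e`, a field with
components `a` along a curve with velocity `u` through `y` is parallel if `a' = -Γ(y)(u, a)`. -/
def christoffelForm [RiemannianBundle (fun x : M ↦ TangentSpace (𝓡 n) x)]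
    (e : OpenPartialHomeomorph M (Coord n)) (y u a : Coord n) : Coord n :=
  WithLp.toLp 2 fun k ↦ ∑ i, ∑ j, christoffel e y k i j * u i * a j

lemma components_injective (he : e ∈ IsManifold.maximalAtlas (𝓡 n) ∞ M) {x : M}
    (hx : x ∈ e.source) :
    Function.Injective (components e : TangentSpace (𝓡 n) x → Coord n) :=
  (mdifferentiable_of_mem_maximalAtlas he (by simp)).mfderiv_injective hx

variable [RiemannianBundle (fun x : M ↦ TangentSpace (𝓡 n) x)]

lemma det_metricMatrix_ne_zero (he : e ∈ IsManifold.maximalAtlas (𝓡 n) ∞ M) {y : Coord n}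
    (hy : y ∈ e.target) : (metricMatrix e y).det ≠ 0 := by
  have hstd : LinearIndependent ℝ (stdVec n) :=
    EuclideanSpace.orthonormal_single.linearIndependent
  have hframe : LinearIndependent ℝ (fun i ↦
      (mfderiv (𝓡 n) (𝓡 n) e.symm y (stdVec n i) : TangentSpace (𝓡 n) (e.symm y))) :=
    hstd.map' (mfderiv (𝓡 n) (𝓡 n) e.symm y).toLinearMap
      ((mdifferentiable_of_mem_maximalAtlas he (by simp)).symm.ker_mfderiv_eq_bot hy)
  exact (Matrix.posDef_gram_of_linearIndependent (𝕜 := ℝ) hframe).det_pos.ne'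

variable [IsManifold (𝓡 n) ∞ M]
  [IsContMDiffRiemannianBundle (𝓡 n) ∞ (Coord n) (fun x : M ↦ TangentSpace (𝓡 n) x)]

lemma contDiffOn_metricMatrix (he : e ∈ IsManifold.maximalAtlas (𝓡 n) ∞ M) (i j : Fin n) :
    ContDiffOn ℝ ∞ (fun y ↦ metricMatrix e y i j) e.target := by
  have hframe (u : Coord n) : ContMDiffOn (𝓡 n) ((𝓡 n).prod 𝓘(ℝ, Coord n)) ∞
      (fun y ↦ (⟨e.symm y, mfderiv (𝓡 n) (𝓡 n) e.symm y u⟩ :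
        TotalSpace (Coord n) (fun x : M ↦ TangentSpace (𝓡 n) x))) e.target := by
    have htangent := (contMDiffOn_symm_of_mem_maximalAtlas he).contMDiffOn_tangentMapWithin
      (m := ∞) (by simp) e.open_target.uniqueMDiffOn
    have hconst : ContMDiff (𝓡 n) ((𝓡 n).prod 𝓘(ℝ, Coord n)) ∞
        (fun y : Coord n ↦ (⟨y, u⟩ : TangentBundle (𝓡 n) (Coord n))) :=
      (contMDiff_vectorSpace_iff_contDiff (V := fun _ ↦ u)).2 contDiff_const
    refine (htangent.comp hconst.contMDiffOn fun y hy ↦ hy).congr fun y hy ↦ ?_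
    simp only [Function.comp_apply, tangentMapWithin, mfderivWithin_of_isOpen e.open_target hy]
  exact ((hframe (stdVec n i)).inner_bundle (hframe (stdVec n j))).contDiffOn

lemma contDiffOn_metricDeriv (he : e ∈ IsManifold.maximalAtlas (𝓡 n) ∞ M) (l i j : Fin n) :
    ContDiffOn ℝ ∞ (fun y ↦ metricDeriv e y l i j) e.target :=
  ((contDiffOn_metricMatrix he i j).fderiv_of_isOpen e.open_target (m := ∞) (by simp)).clm_apply
    contDiffOn_const

lemma contDiffOn_christoffel (he : e ∈ IsManifold.maximalAtlas (𝓡 n) ∞ M) (k i j : Fin n) :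
    ContDiffOn ℝ ∞ (fun y ↦ christoffel e y k i j) e.target :=
  contDiffOn_const.mul (ContDiffOn.sum fun l _ ↦
    (contDiffOn_matrix_inv (contDiffOn_metricMatrix he)
      (fun _ ↦ det_metricMatrix_ne_zero he) k l).mul
    (((contDiffOn_metricDeriv he i j l).add (contDiffOn_metricDeriv he j i l)).sub
      (contDiffOn_metricDeriv he l i j)))

lemma contDiffAt_christoffelForm (he : e ∈ IsManifold.maximalAtlas (𝓡 n) ∞ M) {y : Coord n}
    (hy : y ∈ e.target) (u a : Coord n) :
    ContDiffAt ℝ ∞ (fun p : (Coord n × Coord n) × Coord n ↦ christoffelForm e p.1.1 p.1.2 p.2)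
      ((y, u), a) := by
  simp only [christoffelForm, contDiffAt_euclidean]
  refine fun k ↦ ContDiffAt.sum fun i _ ↦ ContDiffAt.sum fun j _ ↦ ?_
  have hΓ : ContDiffAt ℝ ∞ (fun y ↦ christoffel e y k i j) y :=
    (contDiffOn_christoffel he k i j).contDiffAt (e.open_target.mem_nhds hy)
  have hΓ' : ContDiffAt ℝ ∞
      (fun p : (Coord n × Coord n) × Coord n ↦ christoffel e p.1.1 k i j) ((y, u), a) :=
    ContDiffAt.comp (g := fun y ↦ christoffel e y k i j) ((y, u), a) hΓ (by fun_prop)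
  exact (hΓ'.mul (by fun_prop)).mul (by fun_prop)

end LeviCivita

section Curves

variable {n : ℕ} {M : Type*} [TopologicalSpace M] [ChartedSpace (Coord n) M]

/-- The velocity `γ'(t)` of a curve `γ : [0,1] → M`, one-sided at the end points. -/
def velocity (γ : ℝ → M) (t : ℝ) : TangentSpace (𝓡 n) (γ t) :=
  mfderivWithin 𝓘(ℝ, ℝ) (𝓡 n) γ (Icc 0 1) t (1 : ℝ)

/-- The lift `t ↦ (γ(t), γ'(t))` of a curve `γ : [0,1] → M` to the tangent bundle. -/
def tangentLift (γ : ℝ → M) (t : ℝ) : TangentBundle (𝓡 n) M :=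
  ⟨γ t, velocity γ t⟩

/-- The coordinates on the tangent bundle induced by the chart `e`: position and components. -/
def tangentCoord (e : OpenPartialHomeomorph M (Coord n)) (p : TangentBundle (𝓡 n) M) :
    Coord n × Coord n :=
  (e p.1, components e p.2)

variable {e : OpenPartialHomeomorph M (Coord n)} {γ : ℝ → M} {t : ℝ}

lemma contDiffWithinAt_chart_comp (he : e ∈ IsManifold.maximalAtlas (𝓡 n) ∞ M)
    (hγ : ContMDiffOn 𝓘(ℝ, ℝ) (𝓡 n) ∞ γ (Icc 0 1)) (ht : t ∈ Icc (0 : ℝ) 1)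
    (hte : γ t ∈ e.source) : ContDiffWithinAt ℝ ∞ (fun s ↦ e (γ s)) (Icc 0 1) t :=
  ((contMDiffAt_of_mem_maximalAtlas he hte).comp_contMDiffWithinAt t (hγ t ht)).contDiffWithinAt

lemma tangentCoord_inj (he : e ∈ IsManifold.maximalAtlas (𝓡 n) ∞ M)
    {p q : TangentBundle (𝓡 n) M} (hp : p.1 ∈ e.source) (hq : q.1 ∈ e.source) :
    tangentCoord e p = tangentCoord e q ↔ p = q := by
  refine ⟨fun h ↦ ?_, congrArg _⟩
  obtain ⟨x, v⟩ := p
  obtain ⟨y, w⟩ := q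
  obtain ⟨hpos, hcomp⟩ := Prod.mk.inj h
  obtain rfl : x = y := e.injOn hp hq hpos
  exact congrArg (TotalSpace.mk x) (components_injective he hp hcomp)

lemma hasDerivWithinAt_chart_comp (he : e ∈ IsManifold.maximalAtlas (𝓡 n) ∞ M)
    (hγ : ContMDiffOn 𝓘(ℝ, ℝ) (𝓡 n) ∞ γ (Icc 0 1)) (ht : t ∈ Icc (0 : ℝ) 1)
    (hte : γ t ∈ e.source) :
    HasDerivWithinAt (fun s ↦ e (γ s)) (components e (velocity γ t)) (Icc 0 1) t := by
  have hchart := ((mdifferentiable_of_mem_maximalAtlas he (by simp)).mdifferentiableAt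
    hte).hasMFDerivAt
  have hcurve := ((hγ t ht).mdifferentiableWithinAt (by simp)).hasMFDerivWithinAt
  have hfderiv := (hchart.comp_hasMFDerivWithinAt t hcurve).hasFDerivWithinAt
  exact hasDerivWithinAt_iff_hasFDerivWithinAt.2 (hfderiv.congr_fderiv
    (ContinuousLinearMap.ext_ring (one_smul ℝ (components e (velocity γ t))).symm))

lemma derivWithin_chart_comp (he : e ∈ IsManifold.maximalAtlas (𝓡 n) ∞ M)
    (hγ : ContMDiffOn 𝓘(ℝ, ℝ) (𝓡 n) ∞ γ (Icc 0 1)) (ht : t ∈ Icc (0 : ℝ) 1)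
    (hte : γ t ∈ e.source) (k : Fin n) :
    derivWithin (fun s ↦ e (γ s) k) (Icc 0 1) t = components e (velocity γ t) k :=
  ((EuclideanSpace.proj k : Coord n →L[ℝ] ℝ).hasFDerivAt.comp_hasDerivWithinAt t
    (hasDerivWithinAt_chart_comp he hγ ht hte)).derivWithin (uniqueDiffOn_Icc zero_lt_one t ht)

lemma contDiffWithinAt_components_velocity (he : e ∈ IsManifold.maximalAtlas (𝓡 n) ∞ M)
    (hγ : ContMDiffOn 𝓘(ℝ, ℝ) (𝓡 n) ∞ γ (Icc 0 1)) (ht : t ∈ Icc (0 : ℝ) 1)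
    (hte : γ t ∈ e.source) :
    ContDiffWithinAt ℝ ∞ (fun s ↦ components e (velocity γ s)) (Icc 0 1) t := by
  have hu : UniqueDiffOn ℝ (Icc (0 : ℝ) 1) := uniqueDiffOn_Icc zero_lt_one
  refine ((contDiffWithinAt_chart_comp he hγ ht hte).derivWithin hu (m := ∞) (by simp)
    ht).congr_of_eventuallyEq_of_mem ?_ ht
  filter_upwards [self_mem_nhdsWithin, hγ.continuousOn t ht (e.open_source.mem_nhds hte)]
    with s hs hse
  exact ((hasDerivWithinAt_chart_comp he hγ hs hse).derivWithin (hu s hs)).symm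

end Curves

section Uniqueness

variable {n : ℕ} {M : Type*} [TopologicalSpace M] [ChartedSpace (Coord n) M]
  [RiemannianBundle (fun x : M ↦ TangentSpace (𝓡 n) x)]

/-- The geodesic equation in the chart `e` as a first order system for position and velocity. -/
def geodesicField (e : OpenPartialHomeomorph M (Coord n)) (p : Coord n × Coord n) :
    Coord n × Coord n :=
  (p.2, -christoffelForm e p.1 p.2 p.2)

variable {e : OpenPartialHomeomorph M (Coord n)} {γ γ₁ γ₂ : ℝ → M}
  {X Y : ∀ t, TangentSpace (𝓡 n) (γ t)} {t : ℝ}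

lemma IsParallelAlong.hasDerivWithinAt_components (hX : IsParallelAlong γ X)
    (hγ : ContMDiffOn 𝓘(ℝ, ℝ) (𝓡 n) ∞ γ (Icc 0 1))
    (he : e ∈ IsManifold.maximalAtlas (𝓡 n) ∞ M) (ht : t ∈ Icc (0 : ℝ) 1)
    (hte : γ t ∈ e.source) :
    HasDerivWithinAt (fun s ↦ components e (X s))
      (-christoffelForm e (e (γ t)) (components e (velocity γ t)) (components e (X t)))
      (Icc 0 1) t := by
  refine hasFDerivWithinAt_euclidean.2 fun k ↦ ?_
  have h := hX t ht e he hte k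
  simp only [derivWithin_chart_comp he hγ ht hte] at h
  refine h.hasFDerivWithinAt.congr_fderiv ?_
  ext
  simp [christoffelForm]

lemma IsGeodesic.isParallelAlong_velocity (hγ : IsGeodesic (n := n) γ) :
    IsParallelAlong (n := n) γ (velocity γ) := by
  intro t ht e he hte k
  have hdiff : DifferentiableWithinAt ℝ (fun s ↦ components e (velocity γ s) k) (Icc 0 1) t :=
    (contDiffWithinAt_euclidean.1 (contDiffWithinAt_components_velocity he hγ.smooth ht hte)
      k).differentiableWithinAt (by simp)
  have heq : (fun s ↦ components e (velocity γ s) k) =ᶠ[𝓝[Icc 0 1] t]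
      derivWithin (fun s ↦ e (γ s) k) (Icc 0 1) := by
    filter_upwards [self_mem_nhdsWithin, hγ.smooth.continuousOn t ht (e.open_source.mem_nhds hte)]
      with s hs hse
    exact (derivWithin_chart_comp he hγ.smooth hs hse k).symm
  refine hdiff.hasDerivWithinAt.congr_deriv ?_
  rw [heq.derivWithin_eq_of_mem ht]
  simpa only [← derivWithin_chart_comp he hγ.smooth ht hte, iteratedDerivWithin_succ,
    iteratedDerivWithin_zero] using eq_neg_of_add_eq_zero_left (hγ.equation t ht e he hte k)

lemma IsGeodesic.hasDerivWithinAt_tangentCoord (hγ : IsGeodesic (n := n) γ)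
    (he : e ∈ IsManifold.maximalAtlas (𝓡 n) ∞ M) (ht : t ∈ Icc (0 : ℝ) 1)
    (hte : γ t ∈ e.source) :
    HasDerivWithinAt (fun s ↦ tangentCoord e (tangentLift γ s))
      (geodesicField e (tangentCoord e (tangentLift γ t))) (Icc 0 1) t :=
  (hasDerivWithinAt_chart_comp he hγ.smooth ht hte).prodMk
    (hγ.isParallelAlong_velocity.hasDerivWithinAt_components hγ.smooth he ht hte)

variable [IsManifold (𝓡 n) ∞ M]
  [IsContMDiffRiemannianBundle (𝓡 n) ∞ (Coord n) (fun x : M ↦ TangentSpace (𝓡 n) x)]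

lemma contDiffAt_geodesicField (he : e ∈ IsManifold.maximalAtlas (𝓡 n) ∞ M)
    {p : Coord n × Coord n} (hp : p.1 ∈ e.target) : ContDiffAt ℝ ∞ (geodesicField e) p := by
  have hΓ : ContDiffAt ℝ ∞ (fun q : Coord n × Coord n ↦ christoffelForm e q.1 q.2 q.2) p :=
    (contDiffAt_christoffelForm he hp p.2 p.2).comp p (f := fun q ↦ (q, q.2)) (by fun_prop)
  exact contDiffAt_snd.prodMk hΓ.neg

lemma IsGeodesic.eventually_tangentLift_eq_iff [T2Space M] (h₁ : IsGeodesic (n := n) γ₁)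
    (h₂ : IsGeodesic (n := n) γ₂) (ht : t ∈ Icc (0 : ℝ) 1) :
    ∀ᶠ s in 𝓝[Icc 0 1] t, tangentLift (n := n) γ₁ t = tangentLift γ₂ t ↔
      tangentLift (n := n) γ₁ s = tangentLift γ₂ s := by
  have hc₁ := h₁.smooth.continuousOn t ht
  have hc₂ := h₂.smooth.continuousOn t ht
  rcases ne_or_eq (γ₁ t) (γ₂ t) with hne | heq
  · filter_upwards [(hc₁.prodMk hc₂).eventually (isClosed_diagonal.isOpen_compl.mem_nhds hne)]
      with s hs
    exact iff_of_false (fun h ↦ hne (congrArg TotalSpace.proj h))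
      fun h ↦ hs (congrArg TotalSpace.proj h)
  let e := chartAt (Coord n) (γ₁ t)
  have he : e ∈ IsManifold.maximalAtlas (𝓡 n) ∞ M := IsManifold.chart_mem_maximalAtlas _
  have ht₁ : γ₁ t ∈ e.source := mem_chart_source _ _
  have ht₂ : γ₂ t ∈ e.source := heq ▸ ht₁
  have hs₁ := hc₁ (e.open_source.mem_nhds ht₁)
  have hs₂ := hc₂ (e.open_source.mem_nhds ht₂)
  have hode {γ : ℝ → M} (h : IsGeodesic (n := n) γ) (hs : ∀ᶠ s in 𝓝[Icc 0 1] t, γ s ∈ e.source) :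
      ∀ᶠ s in 𝓝[Icc 0 1] t, HasDerivWithinAt (fun s ↦ tangentCoord e (tangentLift γ s))
        (geodesicField e (tangentCoord e (tangentLift γ s))) (Icc 0 1) s := by
    filter_upwards [self_mem_nhdsWithin, hs] with s hs hse
    exact h.hasDerivWithinAt_tangentCoord he hs hse
  obtain ⟨K, U, hU, hK⟩ := ((contDiffAt_geodesicField he (p := tangentCoord e (tangentLift γ₁ t))
    (e.map_source ht₁)).of_le (m := 1) (by simp)).exists_lipschitzOnWith
  filter_upwards [eventually_eq_iff_of_hasDerivWithinAt (v := fun _ ↦ geodesicField e) ht hU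
    (Eventually.of_forall fun _ ↦ hK) (hode h₁ hs₁) (hode h₂ hs₂), hs₁, hs₂] with s hs hse₁ hse₂
  rwa [tangentCoord_inj he ht₁ ht₂, tangentCoord_inj (p := tangentLift γ₁ s)
    (q := tangentLift γ₂ s) he hse₁ hse₂] at hs

theorem IsGeodesic.eqOn [T2Space M] (h₁ : IsGeodesic (n := n) γ₁)
    (h₂ : IsGeodesic (n := n) γ₂) (h : tangentLift (n := n) γ₁ 0 = tangentLift γ₂ 0) :
    EqOn γ₁ γ₂ (Icc 0 1) := fun _ ht ↦
  congrArg TotalSpace.proj ((iff_of_isPreconnected isPreconnected_Icc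
    (fun _ ↦ h₁.eventually_tangentLift_eq_iff h₂) (left_mem_Icc.2 zero_le_one) ht).1 h)

lemma IsParallelAlong.eventually_eq_iff (hγ : ContMDiffOn 𝓘(ℝ, ℝ) (𝓡 n) ∞ γ (Icc 0 1))
    (hX : IsParallelAlong γ X) (hY : IsParallelAlong γ Y) (ht : t ∈ Icc (0 : ℝ) 1) :
    ∀ᶠ s in 𝓝[Icc 0 1] t, X t = Y t ↔ X s = Y s := by
  let e := chartAt (Coord n) (γ t)
  have he : e ∈ IsManifold.maximalAtlas (𝓡 n) ∞ M := IsManifold.chart_mem_maximalAtlas _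
  have hte : γ t ∈ e.source := mem_chart_source _ _
  have hse := hγ.continuousOn t ht (e.open_source.mem_nhds hte)
  have hpos : ContinuousWithinAt (fun s ↦ tangentCoord e (tangentLift γ s)) (Icc 0 1) t :=
    (contDiffWithinAt_chart_comp he hγ ht hte).continuousWithinAt.prodMk
      (contDiffWithinAt_components_velocity he hγ ht hte).continuousWithinAt
  obtain ⟨K, U, hU, hK⟩ := exists_eventually_lipschitzOnWith
    ((contDiffAt_christoffelForm he (e.map_source hte) (components e (velocity γ t))
      (components e (X t))).neg.of_le (m := 1) (by simp))
  have hode {Z : ∀ t, TangentSpace (𝓡 n) (γ t)} (hZ : IsParallelAlong γ Z) :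
      ∀ᶠ s in 𝓝[Icc 0 1] t, HasDerivWithinAt (fun s ↦ components e (Z s))
        (-christoffelForm e (e (γ s)) (components e (velocity γ s)) (components e (Z s)))
        (Icc 0 1) s := by
    filter_upwards [self_mem_nhdsWithin, hse] with s hs hse
    exact hZ.hasDerivWithinAt_components hγ he hs hse
  filter_upwards [eventually_eq_iff_of_hasDerivWithinAt ht hU (hpos.eventually hK) (hode hX)
    (hode hY), hse] with s hs hse
  rwa [(components_injective he hte).eq_iff, (components_injective he hse).eq_iff] at hs

theorem IsParallelAlong.eq_iff (hγ : ContMDiffOn 𝓘(ℝ, ℝ) (𝓡 n) ∞ γ (Icc 0 1))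
    (hX : IsParallelAlong γ X) (hY : IsParallelAlong γ Y) {s : ℝ} (hs : s ∈ Icc (0 : ℝ) 1)
    (ht : t ∈ Icc (0 : ℝ) 1) : X s = Y s ↔ X t = Y t :=
  iff_of_isPreconnected isPreconnected_Icc (fun _ ↦ hX.eventually_eq_iff hγ hY) hs ht

lemma IsParallelTransport.left_unique (hγ : ContMDiffOn 𝓘(ℝ, ℝ) (𝓡 n) ∞ γ (Icc 0 1))
    {x₀ x : M} {v v' : TangentSpace (𝓡 n) x₀} {w : TangentSpace (𝓡 n) x}
    (h : IsParallelTransport γ v w) (h' : IsParallelTransport γ v' w) : v = v' := by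
  obtain ⟨X, hX, hX₀, hX₁⟩ := h
  obtain ⟨Y, hY, hY₀, hY₁⟩ := h'
  have h₁ : X 1 = Y 1 := TotalSpace.mk_injective (γ 1) (hX₁.trans hY₁.symm)
  have h₀ : X 0 = Y 0 := (hX.eq_iff hγ hY (by simp) (by simp)).2 h₁
  exact TotalSpace.mk_injective x₀ (hX₀.symm.trans ((congrArg (TotalSpace.mk (γ 0)) h₀).trans hY₀))

end Uniqueness

lemma IsGeodesicWith.expMap_eq {n : ℕ} {M : Type*} [TopologicalSpace M] [ChartedSpace (Coord n) M]
    [RiemannianBundle (fun x : M ↦ TangentSpace (𝓡 n) x)] [IsManifold (𝓡 n) ∞ M] [T2Space M]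
    [IsContMDiffRiemannianBundle (𝓡 n) ∞ (Coord n) (fun x : M ↦ TangentSpace (𝓡 n) x)]
    {x : M} {v : TangentSpace (𝓡 n) x} {γ : ℝ → M} (hγ : IsGeodesicWith x v γ) :
    expMap x v = γ 1 := by
  have h : ∃ γ : ℝ → M, IsGeodesicWith x v γ := ⟨γ, hγ⟩
  rw [expMap, dif_pos h]
  exact h.choose_spec.1.eqOn hγ.1 (h.choose_spec.2.trans hγ.2.symm) (right_mem_Icc.2 zero_le_one)

section Congruence

variable {n : ℕ} {M : Type*} [TopologicalSpace M] [ChartedSpace (Coord n) M]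
  [RiemannianBundle (fun x : M ↦ TangentSpace (𝓡 n) x)] {γ γ' : ℝ → M}

lemma IsParallelAlong.congr {X : ∀ t, TangentSpace (𝓡 n) (γ t)}
    {X' : ∀ t, TangentSpace (𝓡 n) (γ' t)} (hX : IsParallelAlong γ X)
    (h : ∀ t ∈ Icc (0 : ℝ) 1, (⟨γ t, X t⟩ : TangentBundle (𝓡 n) M) = ⟨γ' t, X' t⟩) :
    IsParallelAlong γ' X' := by
  intro t ht e he hte k
  have hγ : EqOn γ γ' (Icc 0 1) := fun s hs ↦ congrArg TotalSpace.proj (h s hs)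
  have hcomp : ∀ s ∈ Icc (0 : ℝ) 1, components e (X' s) = components e (X s) := fun s hs ↦
    (congrArg (fun p : TangentBundle (𝓡 n) M ↦ components e p.2) (h s hs)).symm
  have hderiv (i : Fin n) : derivWithin (fun s ↦ (e (γ' s)) i) (Icc 0 1) t =
      derivWithin (fun s ↦ (e (γ s)) i) (Icc 0 1) t :=
    derivWithin_congr (fun s hs ↦ by rw [hγ hs]) (by rw [hγ ht])
  have hXt := hX t ht e he ((hγ ht).symm ▸ hte) k
  simp only [hderiv, hcomp t ht, ← hγ ht]
  exact hXt.congr (fun s hs ↦ by rw [hcomp s hs]) (by rw [hcomp t ht])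

lemma IsParallelTransport.congr {x₀ x : M} {v : TangentSpace (𝓡 n) x₀} {w : TangentSpace (𝓡 n) x}
    (h : IsParallelTransport γ v w) (hγ : EqOn γ γ' (Icc 0 1)) : IsParallelTransport γ' v w := by
  obtain ⟨X, hX, h₀, h₁⟩ := h
  -- All tangent spaces are the same type `Coord n`, so `X` is also a vector field along `γ'`.
  have hX' : ∀ t ∈ Icc (0 : ℝ) 1, (⟨γ t, X t⟩ : TangentBundle (𝓡 n) M) = ⟨γ' t, X t⟩ :=
    fun t ht ↦ congrArg (fun p ↦ (⟨p, X t⟩ : TangentBundle (𝓡 n) M)) (hγ ht)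
  exact ⟨X, hX.congr hX', (hX' 0 (by simp)).symm.trans h₀, (hX' 1 (by simp)).symm.trans h₁⟩

lemma parallelTransportInv_congr (hγ : EqOn γ γ' (Icc 0 1)) (x₀ x : M)
    (w : TangentSpace (𝓡 n) x) :
    parallelTransportInv γ x₀ x w = parallelTransportInv γ' x₀ x w := by
  classical
  have h : (fun v : TangentSpace (𝓡 n) x₀ ↦ IsParallelTransport γ v w) =
      fun v ↦ IsParallelTransport γ' v w :=
    funext fun v ↦ propext ⟨fun h ↦ h.congr hγ, fun h ↦ h.congr hγ.symm⟩
  exact congrArg (fun P : TangentSpace (𝓡 n) x₀ → Prop ↦ if h : ∃ v, P v then h.choose else 0) h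

lemma ptConvolution_congr [MeasurableSpace M] (hγ : EqOn γ γ' (Icc 0 1)) (x₀ : M) (δ : ℝ)
    (k f : M → ℝ) (x : M) : ptConvolution n x₀ δ k f γ x = ptConvolution n x₀ δ k f γ' x := by
  simp only [ptConvolution, ptcIntegrand, transportedKernel, parallelTransportInv_congr hγ]

end Congruence

section Differential

lemma velocity_comp {m n : ℕ} {M N : Type*} [TopologicalSpace M] [ChartedSpace (Coord m) M]
    [TopologicalSpace N] [ChartedSpace (Coord n) N] {Φ : M → N} {γ : ℝ → M} {t : ℝ}
    (hΦ : MDifferentiableAt (𝓡 m) (𝓡 n) Φ (γ t))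
    (hγ : MDifferentiableWithinAt 𝓘(ℝ, ℝ) (𝓡 m) γ (Icc 0 1) t) (ht : t ∈ Icc (0 : ℝ) 1) :
    velocity (Φ ∘ γ) t = mfderiv (𝓡 m) (𝓡 n) Φ (γ t) (velocity γ t) :=
  DFunLike.congr_fun (mfderiv_comp_mfderivWithin t hΦ hγ
    (uniqueMDiffWithinAt_iff_uniqueDiffWithinAt.2 (uniqueDiffOn_Icc zero_lt_one t ht))) (1 : ℝ)

variable {n : ℕ} {M : Type*} [TopologicalSpace M] [ChartedSpace (Coord n) M]
  {N : Type*} [TopologicalSpace N] [ChartedSpace (Coord n) N] {r : ℕ∞ω}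
  {e : OpenPartialHomeomorph N (Coord n)}

lemma components_pullbackChart (Φ : M ≃ₘ^r⟮𝓡 n, 𝓡 n⟯ N) (hr : r ≠ 0)
    (he : e ∈ IsManifold.maximalAtlas (𝓡 n) r N) {x : M} (hx : Φ x ∈ e.source)
    (v : TangentSpace (𝓡 n) x) :
    components (pullbackChart Φ e) v = components e (mfderiv (𝓡 n) (𝓡 n) Φ x v) :=
  DFunLike.congr_fun (mfderiv_comp (g := e) x
    ((mdifferentiable_of_mem_maximalAtlas he hr).mdifferentiableAt hx) (Φ.mdifferentiable hr x)) v

lemma mfderiv_pullbackChart_symm (Φ : M ≃ₘ^r⟮𝓡 n, 𝓡 n⟯ N) (hr : r ≠ 0)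
    (he : e ∈ IsManifold.maximalAtlas (𝓡 n) r N) {y : Coord n} (hy : y ∈ e.target)
    (u : Coord n) :
    mfderiv (𝓡 n) (𝓡 n) (pullbackChart Φ e).symm y u =
      mfderiv (𝓡 n) (𝓡 n) Φ.symm (e.symm y) (mfderiv (𝓡 n) (𝓡 n) e.symm y u) :=
  DFunLike.congr_fun (mfderiv_comp (g := Φ.symm) y (Φ.symm.mdifferentiable hr _)
    ((mdifferentiable_of_mem_maximalAtlas he hr).mdifferentiableAt_symm hy)) u

end Differential

section Isometry

variable {n : ℕ} {M : Type*} [TopologicalSpace M] [ChartedSpace (Coord n) M]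
  [RiemannianBundle (fun x : M ↦ TangentSpace (𝓡 n) x)]
  {N : Type*} [TopologicalSpace N] [ChartedSpace (Coord n) N]
  [RiemannianBundle (fun x : N ↦ TangentSpace (𝓡 n) x)]
  {Φ : M ≃ₘ^∞⟮𝓡 n, 𝓡 n⟯ N}

/-- The differential `dΦ_x : T_x M → T_{Φ x} N` of an isometry, as a linear isometry. -/
def IsRiemannianIsometry.mfderivEquiv (hΦ : IsRiemannianIsometry Φ) (x : M) :
    TangentSpace (𝓡 n) x ≃ₗᵢ[ℝ] TangentSpace (𝓡 n) (Φ x) :=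
  (Φ.mfderivToContinuousLinearEquiv (by simp) x).toLinearEquiv.isometryOfInner (hΦ x)

lemma IsRiemannianIsometry.coe_mfderivEquiv (hΦ : IsRiemannianIsometry Φ) (x : M) :
    ⇑(hΦ.mfderivEquiv x) = mfderiv (𝓡 n) (𝓡 n) Φ x := rfl

lemma inner_tangentSpace_congr {x y : M} (h : x = y) (v w : TangentSpace (𝓡 n) x) :
    inner ℝ (E := TangentSpace (𝓡 n) y) v w = inner ℝ v w := by
  subst h
  rfl

lemma IsRiemannianIsometry.symm (hΦ : IsRiemannianIsometry Φ) :
    IsRiemannianIsometry Φ.symm := by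
  intro y v w
  obtain ⟨x, rfl⟩ : ∃ x, Φ x = y := Φ.surjective y
  obtain ⟨v, rfl⟩ := (hΦ.mfderivEquiv x).surjective v
  obtain ⟨w, rfl⟩ := (hΦ.mfderivEquiv x).surjective w
  rw [(hΦ.mfderivEquiv x).inner_map_map, hΦ.coe_mfderivEquiv,
    mfderiv_symm_apply_mfderiv Φ (by simp), mfderiv_symm_apply_mfderiv Φ (by simp)]
  exact inner_tangentSpace_congr (Φ.symm_apply_apply x).symm v w

section Christoffel

variable {e : OpenPartialHomeomorph N (Coord n)} {y : Coord n}

lemma IsRiemannianIsometry.metricMatrix_pullbackChart (hΦ : IsRiemannianIsometry Φ)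
    (he : e ∈ IsManifold.maximalAtlas (𝓡 n) ∞ N) (hy : y ∈ e.target) :
    metricMatrix (pullbackChart Φ e) y = metricMatrix e y := by
  ext i j
  rw [metricMatrix, Matrix.of_apply, mfderiv_pullbackChart_symm Φ (by simp) he hy,
    mfderiv_pullbackChart_symm Φ (by simp) he hy]
  exact hΦ.symm _ _ _

lemma IsRiemannianIsometry.metricDeriv_pullbackChart (hΦ : IsRiemannianIsometry Φ)
    (he : e ∈ IsManifold.maximalAtlas (𝓡 n) ∞ N) (hy : y ∈ e.target) (l i j : Fin n) :
    metricDeriv (pullbackChart Φ e) y l i j = metricDeriv e y l i j := by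
  have h : (fun z ↦ metricMatrix (pullbackChart Φ e) z i j) =ᶠ[𝓝 y]
      fun z ↦ metricMatrix e z i j := by
    filter_upwards [e.open_target.mem_nhds hy] with z hz
    rw [hΦ.metricMatrix_pullbackChart he hz]
  rw [metricDeriv, h.fderiv_eq, metricDeriv]

lemma IsRiemannianIsometry.christoffel_pullbackChart (hΦ : IsRiemannianIsometry Φ)
    (he : e ∈ IsManifold.maximalAtlas (𝓡 n) ∞ N) (hy : y ∈ e.target) (k i j : Fin n) :
    christoffel (pullbackChart Φ e) y k i j = christoffel e y k i j := by
  simp only [christoffel, hΦ.metricDeriv_pullbackChart he hy, hΦ.metricMatrix_pullbackChart he hy]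

end Christoffel

section Distance

lemma IsRiemannianIsometry.pathELength_comp (hΦ : IsRiemannianIsometry Φ) {γ : ℝ → M}
    (hγ : ContMDiffOn 𝓘(ℝ, ℝ) (𝓡 n) 1 γ (Icc 0 1)) :
    pathELength (𝓡 n) (Φ ∘ γ) 0 1 = pathELength (𝓡 n) γ 0 1 := by
  simp only [pathELength_eq_lintegral_mfderivWithin_Icc]
  refine setLIntegral_congr_fun measurableSet_Icc fun t ht ↦ ?_
  have hvel := velocity_comp (Φ.mdifferentiable (by simp) (γ t))
    ((hγ t ht).mdifferentiableWithinAt one_ne_zero) ht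
  exact (congrArg (fun w : TangentSpace (𝓡 n) (Φ (γ t)) ↦ ‖w‖ₑ) hvel).trans
    ((hΦ.mfderivEquiv (γ t)).enorm_map (velocity γ t))

lemma IsRiemannianIsometry.riemannianEDist_le (hΦ : IsRiemannianIsometry Φ) (x y : M) :
    riemannianEDist (𝓡 n) (Φ x) (Φ y) ≤ riemannianEDist (𝓡 n) x y := by
  refine le_of_forall_gt fun r hr ↦ ?_
  obtain ⟨γ, h₀, h₁, hγ, hlen⟩ := exists_lt_of_riemannianEDist_lt hr
  refine lt_of_le_of_lt ?_ hlen
  rw [← hΦ.pathELength_comp hγ]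
  exact riemannianEDist_le_pathELength ((Φ.contMDiff.of_le (by simp)).comp_contMDiffOn hγ)
    (congrArg Φ h₀) (congrArg Φ h₁) zero_le_one

lemma IsRiemannianIsometry.riemannianEDist_eq (hΦ : IsRiemannianIsometry Φ) (x y : M) :
    riemannianEDist (𝓡 n) (Φ x) (Φ y) = riemannianEDist (𝓡 n) x y :=
  (hΦ.riemannianEDist_le x y).antisymm <| by
    simpa only [Φ.symm_apply_apply] using hΦ.symm.riemannianEDist_le (Φ x) (Φ y)

end Distance

end Isometry

section Volume

variable {n : ℕ} {M : Type*} [TopologicalSpace M] [ChartedSpace (Coord n) M]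
  [RiemannianBundle (fun x : M ↦ TangentSpace (𝓡 n) x)]
  [MeasurableSpace M] [BorelSpace M]
  {N : Type*} [TopologicalSpace N] [ChartedSpace (Coord n) N]
  [RiemannianBundle (fun x : N ↦ TangentSpace (𝓡 n) x)]
  [MeasurableSpace N] [BorelSpace N]
  {Φ : M ≃ₘ^∞⟮𝓡 n, 𝓡 n⟯ N}

lemma IsRiemannianIsometry.map_chartVolume_pullbackChart (hΦ : IsRiemannianIsometry Φ)
    {e : OpenPartialHomeomorph N (Coord n)} (he : e ∈ IsManifold.maximalAtlas (𝓡 n) ∞ N) :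
    (chartVolume n (pullbackChart Φ e)).map Φ = chartVolume n e := by
  have hdensity : (volume.restrict e.target).withDensity
        (fun y ↦ ENNReal.ofReal (Real.sqrt (metricMatrix (pullbackChart Φ e) y).det)) =
      (volume.restrict e.target).withDensity
        (fun y ↦ ENNReal.ofReal (Real.sqrt (metricMatrix e y).det)) := by
    refine withDensity_congr_ae ?_
    filter_upwards [ae_restrict_mem e.open_target.measurableSet] with y hy
    rw [hΦ.metricMatrix_pullbackChart he hy]
  have hmeas : AEMeasurable (pullbackChart Φ e).symm ((volume.restrict e.target).withDensity
      (fun y ↦ ENNReal.ofReal (Real.sqrt (metricMatrix e y).det))) :=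
    ((pullbackChart Φ e).continuousOn_symm.aemeasurable e.open_target.measurableSet).mono_ac
      (withDensity_absolutelyContinuous _ _)
  have hsymm : Φ ∘ (pullbackChart Φ e).symm = e.symm :=
    funext fun y ↦ Φ.apply_symm_apply (e.symm y)
  rw [chartVolume, pullbackChart_target, hdensity, AEMeasurable.map_map_of_aemeasurable
    Φ.continuous.measurable.aemeasurable hmeas, hsymm, chartVolume]

variable [IsManifold (𝓡 n) ∞ M]

lemma IsRiemannianIsometry.riemannianVolume_le_map (hΦ : IsRiemannianIsometry Φ) :
    riemannianVolume n N ≤ (riemannianVolume n M).map Φ := by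
  refine iSup₂_le fun e he ↦ ?_
  rw [← hΦ.map_chartVolume_pullbackChart he]
  exact Measure.map_mono (le_iSup₂ (f := fun e _ ↦ chartVolume n e) (pullbackChart Φ e)
    (pullbackChart_mem_maximalAtlas Φ he)) Φ.continuous.measurable

theorem IsRiemannianIsometry.map_riemannianVolume [IsManifold (𝓡 n) ∞ N]
    (hΦ : IsRiemannianIsometry Φ) :
    (riemannianVolume n M).map Φ = riemannianVolume n N := by
  refine le_antisymm ?_ hΦ.riemannianVolume_le_map
  calc (riemannianVolume n M).map Φ
      ≤ ((riemannianVolume n N).map Φ.symm).map Φ :=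
        Measure.map_mono hΦ.symm.riemannianVolume_le_map Φ.continuous.measurable
    _ = riemannianVolume n N := Φ.toHomeomorph.toMeasurableEquiv.map_map_symm

end Volume

open Classical in
lemma dite_choose_map {E F : Type*} [Zero E] [Zero F] {P : E → Prop} {Q : F → Prop} {L : E → F}
    (hL : Function.Surjective L) (hL₀ : L 0 = 0) (hPQ : ∀ v, Q (L v) ↔ P v)
    (hP : ∀ v v', P v → P v' → v = v') :
    (if h : ∃ w, Q w then h.choose else 0) = L (if h : ∃ v, P v then h.choose else 0) := by
  by_cases h : ∃ v, P v
  · have hQ : ∃ w, Q w := h.imp' L fun v ↦ (hPQ v).2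
    obtain ⟨v, hv⟩ := hL hQ.choose
    rw [dif_pos h, dif_pos hQ, ← hv, hP v h.choose ((hPQ v).1 (hv ▸ hQ.choose_spec)) h.choose_spec]
  · have hQ : ¬ ∃ w, Q w := fun hQ ↦ h <| by
      obtain ⟨w, hw⟩ := hQ
      obtain ⟨v, rfl⟩ := hL w
      exact ⟨v, (hPQ v).1 hw⟩
    rw [dif_neg h, dif_neg hQ, hL₀]

section Naturality

variable {n : ℕ} {M : Type*} [TopologicalSpace M] [ChartedSpace (Coord n) M]
  [RiemannianBundle (fun x : M ↦ TangentSpace (𝓡 n) x)] [IsManifold (𝓡 n) ∞ M]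
  {N : Type*} [TopologicalSpace N] [ChartedSpace (Coord n) N]
  [RiemannianBundle (fun x : N ↦ TangentSpace (𝓡 n) x)]
  {Φ : M ≃ₘ^∞⟮𝓡 n, 𝓡 n⟯ N} {γ : ℝ → M} {x₀ x : M}

lemma IsRiemannianIsometry.isGeodesic_comp (hΦ : IsRiemannianIsometry Φ)
    (hγ : IsGeodesic (n := n) γ) : IsGeodesic (n := n) (Φ ∘ γ) where
  smooth := Φ.contMDiff.comp_contMDiffOn hγ.smooth
  equation t ht e he hte k := by
    have hΓ := hΦ.christoffel_pullbackChart he (y := e (Φ (γ t))) (e.map_source hte)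
    simpa only [pullbackChart_apply, Function.comp_apply, hΓ] using
      hγ.equation t ht _ (pullbackChart_mem_maximalAtlas Φ he) hte k

lemma IsRiemannianIsometry.isGeodesicFromTo_comp (hΦ : IsRiemannianIsometry Φ)
    (hγ : IsGeodesicFromTo (n := n) x₀ x γ) :
    IsGeodesicFromTo (n := n) (Φ x₀) (Φ x) (Φ ∘ γ) where
  geodesic := hΦ.isGeodesic_comp hγ.geodesic
  source := congrArg Φ hγ.source
  target := congrArg Φ hγ.target

lemma IsRiemannianIsometry.isMinGeodesicFromTo_comp (hΦ : IsRiemannianIsometry Φ)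
    (hγ : IsMinGeodesicFromTo (n := n) x₀ x γ) :
    IsMinGeodesicFromTo (n := n) (Φ x₀) (Φ x) (Φ ∘ γ) where
  toIsGeodesicFromTo := hΦ.isGeodesicFromTo_comp hγ.toIsGeodesicFromTo
  minimizing := by
    rw [hΦ.pathELength_comp (hγ.geodesic.smooth.of_le (by simp)), hγ.minimizing,
      hΦ.riemannianEDist_eq]

lemma IsRiemannianIsometry.isGeodesicWith_comp (hΦ : IsRiemannianIsometry Φ)
    {v : TangentSpace (𝓡 n) x} (hγ : IsGeodesicWith x v γ) :
    IsGeodesicWith (Φ x) (mfderiv (𝓡 n) (𝓡 n) Φ x v) (Φ ∘ γ) := by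
  have h₀ : (0 : ℝ) ∈ Icc (0 : ℝ) 1 := left_mem_Icc.2 zero_le_one
  have hvel := velocity_comp (Φ.mdifferentiable (by simp) (γ 0))
    ((hγ.1.smooth 0 h₀).mdifferentiableWithinAt (by simp)) h₀
  exact ⟨hΦ.isGeodesic_comp hγ.1, (congrArg (TotalSpace.mk (Φ (γ 0))) hvel).trans
    (congrArg (tangentMap (𝓡 n) (𝓡 n) Φ) hγ.2)⟩

lemma IsRiemannianIsometry.isParallelAlong_comp (hΦ : IsRiemannianIsometry Φ)
    (hγ : ContinuousOn γ (Icc 0 1)) {X : ∀ t, TangentSpace (𝓡 n) (γ t)}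
    (hX : IsParallelAlong γ X) :
    IsParallelAlong (Φ ∘ γ) (fun t ↦ mfderiv (𝓡 n) (𝓡 n) Φ (γ t) (X t)) := by
  intro t ht e he hte k
  have hcomp : (fun s ↦ components e (mfderiv (𝓡 n) (𝓡 n) Φ (γ s) (X s)) k) =ᶠ[𝓝[Icc 0 1] t]
      fun s ↦ components (pullbackChart Φ e) (X s) k := by
    filter_upwards [hγ t ht ((pullbackChart Φ e).open_source.mem_nhds hte)] with s hs
    rw [components_pullbackChart Φ (by simp) he hs]
  have hΓ := hΦ.christoffel_pullbackChart he (y := e (Φ (γ t))) (e.map_source hte)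
  simpa only [pullbackChart_apply, Function.comp_apply, hΓ,
    components_pullbackChart Φ (by simp) he hte] using
    (hX t ht _ (pullbackChart_mem_maximalAtlas Φ he) hte k).congr_of_eventuallyEq hcomp
      (hcomp.self_of_nhdsWithin ht)

lemma IsRiemannianIsometry.isParallelTransport_comp (hΦ : IsRiemannianIsometry Φ)
    (hγ : ContinuousOn γ (Icc 0 1)) {v : TangentSpace (𝓡 n) x₀} {w : TangentSpace (𝓡 n) x}
    (h : IsParallelTransport γ v w) :
    IsParallelTransport (Φ ∘ γ) (mfderiv (𝓡 n) (𝓡 n) Φ x₀ v) (mfderiv (𝓡 n) (𝓡 n) Φ x w) := by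
  obtain ⟨X, hX, h₀, h₁⟩ := h
  exact ⟨_, hΦ.isParallelAlong_comp hγ hX, congrArg (tangentMap (𝓡 n) (𝓡 n) Φ) h₀,
    congrArg (tangentMap (𝓡 n) (𝓡 n) Φ) h₁⟩

variable [IsManifold (𝓡 n) ∞ N]

lemma IsRiemannianIsometry.exists_isGeodesicWith_iff (hΦ : IsRiemannianIsometry Φ) (x : M)
    (v : TangentSpace (𝓡 n) x) :
    (∃ γ : ℝ → N, IsGeodesicWith (Φ x) (mfderiv (𝓡 n) (𝓡 n) Φ x v) γ) ↔
      ∃ γ : ℝ → M, IsGeodesicWith x v γ := by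
  refine ⟨fun ⟨γ, hγ⟩ ↦ ⟨Φ.symm ∘ γ, ?_⟩, fun ⟨γ, hγ⟩ ↦ ⟨Φ ∘ γ, hΦ.isGeodesicWith_comp hγ⟩⟩
  obtain ⟨hgeod, hinit⟩ := hΦ.symm.isGeodesicWith_comp hγ
  exact ⟨hgeod, hinit.trans (tangentMap_symm_tangentMap Φ (by simp) ⟨x, v⟩)⟩

lemma IsRiemannianIsometry.isParallelTransport_comp_iff (hΦ : IsRiemannianIsometry Φ)
    (hγ : ContinuousOn γ (Icc 0 1)) (v : TangentSpace (𝓡 n) x₀) (w : TangentSpace (𝓡 n) x) :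
    IsParallelTransport γ v w ↔
      IsParallelTransport (Φ ∘ γ) (mfderiv (𝓡 n) (𝓡 n) Φ x₀ v) (mfderiv (𝓡 n) (𝓡 n) Φ x w) := by
  refine ⟨hΦ.isParallelTransport_comp hγ, fun h ↦ ?_⟩
  obtain ⟨X, hX, h₀, h₁⟩ := (hΦ.symm.isParallelTransport_comp
    (Φ.continuous.comp_continuousOn hγ) h).congr (γ' := γ) fun t _ ↦ Φ.symm_apply_apply (γ t)
  exact ⟨X, hX, h₀.trans (tangentMap_symm_tangentMap Φ (by simp) ⟨x₀, v⟩),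
    h₁.trans (tangentMap_symm_tangentMap Φ (by simp) ⟨x, w⟩)⟩

section ParallelTransport

variable [IsContMDiffRiemannianBundle (𝓡 n) ∞ (Coord n) (fun x : M ↦ TangentSpace (𝓡 n) x)]

lemma IsRiemannianIsometry.parallelTransportInv_comp (hΦ : IsRiemannianIsometry Φ)
    (hγ : ContMDiffOn 𝓘(ℝ, ℝ) (𝓡 n) ∞ γ (Icc 0 1)) (x₀ x : M) (w : TangentSpace (𝓡 n) x) :
    parallelTransportInv (Φ ∘ γ) (Φ x₀) (Φ x) (mfderiv (𝓡 n) (𝓡 n) Φ x w) =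
      mfderiv (𝓡 n) (𝓡 n) Φ x₀ (parallelTransportInv γ x₀ x w) :=
  dite_choose_map (hΦ.mfderivEquiv x₀).surjective (hΦ.mfderivEquiv x₀).map_zero
    (fun v ↦ (hΦ.isParallelTransport_comp_iff hγ.continuousOn v w).symm)
    fun _ _ h h' ↦ h.left_unique hγ h'

end ParallelTransport

variable [T2Space M] [T2Space N]
  [IsContMDiffRiemannianBundle (𝓡 n) ∞ (Coord n) (fun x : M ↦ TangentSpace (𝓡 n) x)]
  [IsContMDiffRiemannianBundle (𝓡 n) ∞ (Coord n) (fun x : N ↦ TangentSpace (𝓡 n) x)]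

lemma IsRiemannianIsometry.expMap_mfderiv (hΦ : IsRiemannianIsometry Φ) (x : M)
    (v : TangentSpace (𝓡 n) x) :
    expMap (Φ x) (mfderiv (𝓡 n) (𝓡 n) Φ x v) = Φ (expMap x v) := by
  by_cases h : ∃ γ : ℝ → M, IsGeodesicWith x v γ
  · obtain ⟨γ, hγ⟩ := h
    rw [hγ.expMap_eq, (hΦ.isGeodesicWith_comp hγ).expMap_eq, Function.comp_apply]
  · rw [expMap, dif_neg (mt (hΦ.exists_isGeodesicWith_iff x v).1 h), expMap, dif_neg h]

lemma IsRiemannianIsometry.expMap_eq_comp (hΦ : IsRiemannianIsometry Φ) (x : M) :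
    expMap (n := n) (Φ x) = Φ ∘ expMap (n := n) x ∘ (hΦ.mfderivEquiv x).symm := by
  funext w
  obtain ⟨v, rfl⟩ := (hΦ.mfderivEquiv x).surjective w
  rw [Function.comp_apply, Function.comp_apply, LinearIsometryEquiv.symm_apply_apply]
  exact hΦ.expMap_mfderiv x v

end Naturality

section Invariance

variable {n : ℕ} {M : Type*} [TopologicalSpace M] [ChartedSpace (Coord n) M]
  [RiemannianBundle (fun x : M ↦ TangentSpace (𝓡 n) x)] {δ : ℝ}

lemma expMap_injOn_of_lt_injectivityRadius (hδ : ENNReal.ofReal δ < injectivityRadius n M)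
    (x : M) : InjOn (expMap (n := n) x) {v | ‖v‖ ≤ δ} := by
  obtain ⟨r, ⟨-, hinj, -⟩, hδr⟩ := lt_sSup_iff.1 (hδ.trans_le (iInf_le _ x))
  refine hinj.mono fun v hv ↦ ?_
  rw [mem_ofPred_eq, ← ofReal_norm]
  exact (ENNReal.ofReal_le_ofReal hv).trans_lt hδr

variable {N : Type*} [TopologicalSpace N] [ChartedSpace (Coord n) N]
  [RiemannianBundle (fun x : N ↦ TangentSpace (𝓡 n) x)] {Φ : M ≃ₘ^∞⟮𝓡 n, 𝓡 n⟯ N}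
  [IsManifold (𝓡 n) ∞ M] [IsManifold (𝓡 n) ∞ N] [T2Space M] [T2Space N]
  [IsContMDiffRiemannianBundle (𝓡 n) ∞ (Coord n) (fun x : M ↦ TangentSpace (𝓡 n) x)]
  [IsContMDiffRiemannianBundle (𝓡 n) ∞ (Coord n) (fun x : N ↦ TangentSpace (𝓡 n) x)]

lemma IsRiemannianIsometry.injectivityRadiusAt_le (hΦ : IsRiemannianIsometry Φ) (x : M) :
    injectivityRadiusAt n x ≤ injectivityRadiusAt n (Φ x) := by
  refine sSup_le_sSup fun r ⟨hex, hinj, hloc⟩ ↦ ?_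
  let L := (hΦ.mfderivEquiv x).symm
  have hL : MapsTo L {w | ‖w‖ₑ < r} {v | ‖v‖ₑ < r} := fun w hw ↦ (L.enorm_map w).trans_lt hw
  refine ⟨fun w hw ↦ ?_, ?_, ?_⟩
  · rw [← (hΦ.mfderivEquiv x).apply_symm_apply w]
    exact (hΦ.exists_isGeodesicWith_iff x (L w)).2 (hex _ (hL hw))
  · rw [hΦ.expMap_eq_comp]
    exact Φ.injective.comp_injOn (hinj.comp L.injective.injOn hL)
  · rw [hΦ.expMap_eq_comp]
    rintro ⟨w, hw⟩
    have hLw : IsLocalDiffeomorphAt 𝓘(ℝ, TangentSpace (𝓡 n) (Φ x)) 𝓘(ℝ, TangentSpace (𝓡 n) x) ∞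
        L w := L.toContinuousLinearEquiv.toDiffeomorph.isLocalDiffeomorph w
    exact (hLw.comp _ _ (hloc ⟨L w, hL hw⟩)).comp _ _ (Φ.isLocalDiffeomorph _)

lemma IsRiemannianIsometry.injectivityRadius_le (hΦ : IsRiemannianIsometry Φ) :
    injectivityRadius n M ≤ injectivityRadius n N := by
  refine le_iInf fun y ↦ ?_
  obtain ⟨x, rfl⟩ := Φ.surjective y
  exact (iInf_le _ x).trans (hΦ.injectivityRadiusAt_le x)

lemma IsRiemannianIsometry.isKernel_comp (hΦ : IsRiemannianIsometry Φ) {x₀ : M} {k : M → ℝ}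
    (hk : IsKernel n x₀ δ k) : IsKernel n (Φ x₀) δ (k ∘ Φ.symm) where
  pos := hk.pos
  lt_injectivityRadius := hk.lt_injectivityRadius.trans_le hΦ.injectivityRadius_le
  support y hy := hk.support _ <| by
    rwa [← hΦ.riemannianEDist_eq, Φ.apply_symm_apply]

lemma IsRiemannianIsometry.logMap_comp (hΦ : IsRiemannianIsometry Φ)
    (hδ : ENNReal.ofReal δ < injectivityRadius n M) (x y : M) :
    logMap δ (Φ x) (Φ y) = mfderiv (𝓡 n) (𝓡 n) Φ x (logMap δ x y) := by
  refine dite_choose_map (hΦ.mfderivEquiv x).surjective (hΦ.mfderivEquiv x).map_zero (fun v ↦ ?_)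
    fun v v' h h' ↦ expMap_injOn_of_lt_injectivityRadius hδ x h.1 h'.1 (h.2.trans h'.2.symm)
  rw [← hΦ.coe_mfderivEquiv, (hΦ.mfderivEquiv x).norm_map, hΦ.coe_mfderivEquiv, hΦ.expMap_mfderiv]
  exact and_congr_right' Φ.injective.eq_iff

lemma IsRiemannianIsometry.ptcIntegrand_comp (hΦ : IsRiemannianIsometry Φ)
    (hδ : ENNReal.ofReal δ < injectivityRadius n M) {γ : ℝ → M}
    (hγ : ContMDiffOn 𝓘(ℝ, ℝ) (𝓡 n) ∞ γ (Icc 0 1)) (x₀ : M) (k f : M → ℝ) (x : M) :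
    ptcIntegrand n (Φ x₀) δ (k ∘ Φ.symm) (f ∘ Φ.symm) (Φ ∘ γ) (Φ x) ∘ Φ =
      ptcIntegrand n x₀ δ k f γ x := by
  ext y
  simp only [Function.comp_apply, ptcIntegrand, transportedKernel, hΦ.riemannianEDist_eq,
    hΦ.logMap_comp hδ, hΦ.parallelTransportInv_comp hγ, hΦ.expMap_mfderiv,
    Diffeomorph.symm_apply_apply]

variable [MeasurableSpace M] [BorelSpace M] [MeasurableSpace N] [BorelSpace N]

lemma IsRiemannianIsometry.integrable_ptcIntegrand_comp_iff (hΦ : IsRiemannianIsometry Φ)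
    (hδ : ENNReal.ofReal δ < injectivityRadius n M) {γ : ℝ → M}
    (hγ : ContMDiffOn 𝓘(ℝ, ℝ) (𝓡 n) ∞ γ (Icc 0 1)) (x₀ : M) (k f : M → ℝ) (x : M) :
    Integrable (ptcIntegrand n (Φ x₀) δ (k ∘ Φ.symm) (f ∘ Φ.symm) (Φ ∘ γ) (Φ x))
        (riemannianVolume n N) ↔
      Integrable (ptcIntegrand n x₀ δ k f γ x) (riemannianVolume n M) := by
  rw [← hΦ.map_riemannianVolume, ← hΦ.ptcIntegrand_comp hδ hγ]
  exact Φ.toHomeomorph.measurableEmbedding.integrable_map_iff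

theorem IsRiemannianIsometry.ptConvolution_comp (hΦ : IsRiemannianIsometry Φ)
    (hδ : ENNReal.ofReal δ < injectivityRadius n M) {γ : ℝ → M}
    (hγ : ContMDiffOn 𝓘(ℝ, ℝ) (𝓡 n) ∞ γ (Icc 0 1)) (x₀ : M) (k f : M → ℝ) (x : M) :
    ptConvolution n (Φ x₀) δ (k ∘ Φ.symm) (f ∘ Φ.symm) (Φ ∘ γ) (Φ x) =
      ptConvolution n x₀ δ k f γ x := by
  rw [ptConvolution, ptConvolution, ← hΦ.map_riemannianVolume, ← hΦ.ptcIntegrand_comp hδ hγ]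
  exact Φ.toHomeomorph.measurableEmbedding.integral_map _

end Invariance

end PTC

end

theorem mainTheorem7 {n : ℕ} {M N : Type*}
    [TopologicalSpace M] [T2Space M] [SecondCountableTopology M]
    [ChartedSpace (PTC.Coord n) M] [IsManifold (𝓡 n) ∞ M]
    [RiemannianBundle (fun x : M ↦ TangentSpace (𝓡 n) x)]
    [IsContMDiffRiemannianBundle (𝓡 n) ∞ (PTC.Coord n) (fun x : M ↦ TangentSpace (𝓡 n) x)]
    [MeasurableSpace M] [BorelSpace M]
    [TopologicalSpace N] [T2Space N] [SecondCountableTopology N]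
    [ChartedSpace (PTC.Coord n) N] [IsManifold (𝓡 n) ∞ N]
    [RiemannianBundle (fun x : N ↦ TangentSpace (𝓡 n) x)]
    [IsContMDiffRiemannianBundle (𝓡 n) ∞ (PTC.Coord n) (fun x : N ↦ TangentSpace (𝓡 n) x)]
    [MeasurableSpace N] [BorelSpace N]
    (Φ : M ≃ₘ^∞⟮𝓡 n, 𝓡 n⟯ N) (hΦ : PTC.IsRiemannianIsometry Φ)
    (x₀ : M) (δ : ℝ) (k : M → ℝ) (hk : PTC.IsKernel n x₀ δ k) (f : M → ℝ) :
    -- the transplanted kernel is a kernel on `N` centred at `Φ x₀`, with the same radius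
    PTC.IsKernel n (Φ x₀) δ (k ∘ Φ.symm) ∧
    -- the volume measure is preserved
    (PTC.riemannianVolume n M).map Φ = PTC.riemannianVolume n N ∧
    -- for every `x` and every geodesic `γ` from `x₀` to `x`:
    (∀ (x : M) (γ : ℝ → M), PTC.IsGeodesicFromTo (n := n) x₀ x γ →
      PTC.IsGeodesicFromTo (n := n) (Φ x₀) (Φ x) (Φ ∘ γ) ∧
      (PTC.IsMinGeodesicFromTo (n := n) x₀ x γ →
        PTC.IsMinGeodesicFromTo (n := n) (Φ x₀) (Φ x) (Φ ∘ γ)) ∧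
      (∀ (v : TangentSpace (𝓡 n) x₀) (w : TangentSpace (𝓡 n) x),
        PTC.IsParallelTransport γ v w ↔
          PTC.IsParallelTransport (Φ ∘ γ)
            (mfderiv (𝓡 n) (𝓡 n) Φ x₀ v) (mfderiv (𝓡 n) (𝓡 n) Φ x w)) ∧
      (Integrable (PTC.ptcIntegrand n (Φ x₀) δ (k ∘ Φ.symm) (f ∘ Φ.symm) (Φ ∘ γ) (Φ x))
          (PTC.riemannianVolume n N) ↔
        Integrable (PTC.ptcIntegrand n x₀ δ k f γ x) (PTC.riemannianVolume n M)) ∧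
      PTC.ptConvolution n (Φ x₀) δ (k ∘ Φ.symm) (f ∘ Φ.symm) (Φ ∘ γ) (Φ x) =
        PTC.ptConvolution n x₀ δ k f γ x) ∧
    -- if the minimizing geodesic from `x₀` to `x` is unique, then the convolution at `x` and at
    -- `Φ x`, taken along any minimizing geodesics, coincide
    (∀ (x : M) (γ : ℝ → M) (γ' : ℝ → N), PTC.IsMinGeodesicFromTo (n := n) x₀ x γ →
      (∀ γ₁ : ℝ → M, PTC.IsMinGeodesicFromTo (n := n) x₀ x γ₁ → EqOn γ₁ γ (Icc 0 1)) →
      PTC.IsMinGeodesicFromTo (n := n) (Φ x₀) (Φ x) γ' →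
      PTC.ptConvolution n (Φ x₀) δ (k ∘ Φ.symm) (f ∘ Φ.symm) γ' (Φ x) =
        PTC.ptConvolution n x₀ δ k f γ x) := by
  have hδ := hk.lt_injectivityRadius
  refine ⟨hΦ.isKernel_comp hk, hΦ.map_riemannianVolume, fun x γ hγ ↦ ?_,
    fun x γ γ' hγ hunique hγ' ↦ ?_⟩
  · have hsmooth := hγ.geodesic.smooth
    exact ⟨hΦ.isGeodesicFromTo_comp hγ, hΦ.isMinGeodesicFromTo_comp,
      hΦ.isParallelTransport_comp_iff hsmooth.continuousOn,
      hΦ.integrable_ptcIntegrand_comp_iff hδ hsmooth x₀ k f x,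
      hΦ.ptConvolution_comp hδ hsmooth x₀ k f x⟩
  · have hmin := hΦ.symm.isMinGeodesicFromTo_comp hγ'
    rw [Φ.symm_apply_apply, Φ.symm_apply_apply] at hmin
    have heq : EqOn γ' (Φ ∘ γ) (Icc 0 1) := fun t ht ↦
      Φ.toEquiv.symm_apply_eq.1 (hunique _ hmin ht)
    rw [PTC.ptConvolution_congr heq, hΦ.ptConvolution_comp hδ hγ.geodesic.smooth]
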